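/- Let $n,m,p,r\ge 0$ and let $A\in\mathbb R^{n\times n}$, $B\in\mathbb R^{n\times m}$, $C\in\mathbb R^{p\times n}$, $D\in\mathbb R^{p\times m}$, $K\in\mathbb R^{r\times n}$. Consider the system $$\dot x(t)=Ax(t)+Bu(t),\qquad y(t)=Cx(t)+Du(t),\qquad z(t)=Kx(t).\tag{1}$$ A solution of (1) is a tuple $(x,u,y,z)$ of locally Lebesgue integrable functions on $\mathbb R$ with $x$ locally absolutely continuous such that the equations hold for almost all $t\in\mathbb R$; solutions of the system (2) below are defined in the same way. For a function $f$, "$f(t)\to0$ as $t\to\infty$" means $\lim_{t\to\infty}\operatorname{ess\,sup}_{s\ge t}\|f(s)\|=0$. A real square matrix is called stable if all its complex eigenvalues have negative real part. The pair $(A,C)$ is partially detectable with respect to $K$ if $z_1(t)-z_2(t)\to0$ as $t\to\infty$ for all solutions $(x_1,u,y,z_1)$ and $(x_2,u,y,z_2)$ of (1). A system $$\dot w(t)=Nw(t)+Hu(t)+Ly(t),\qquad \hat z(t)=Rw(t)\tag{2}$$ with $N\in\mathbb R^{q\times q}$, $H\in\mathbb R^{q\times m}$, $L\in\mathbb R^{q\times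 p}$, $R\in\mathbb R^{r\times q}$ for some $q\ge0$ is a partial state estimator for (1) if $\hat z(t)-z(t)\to0$ as $t\to\infty$ for every solution $(x,u,y,z)$ of (1) and every solution $(w,(u,y),\hat z)$ of (2) with the same $u$ and $y$. **Theorem.** If $(A,C)$ is partially detectable with respect to $K$, then there exists a partial state estimator of the form (2) for (1). More explicitly, there exist $q\ge 0$ and matrices $T\in\mathbb R^{q\times n}$, $L\in\mathbb R^{q\times p}$ such that $$N:=(TA-LC)T^\top\ \text{is stable},\qquad NT+LC=TA,\qquad KT^\top T=K,$$ and for every $q\ge0$ and all such $T,L$ the system (2) with this $N$ and $L$, $H:=TB-LD$ and $R:=KT^\top$ is a partial state estimator for (1). -/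

import Mathlib

open MeasureTheory Filter Topology Matrix

/-- Data of a linear time-invariant system
`ẋ = A x + B u`, `y = C x + D u`, `z = K x`
with state in `ℝⁿ`, input in `ℝᵐ`, output in `ℝᵖ` and functional to be estimated in `ℝʳ`. -/
structure LTISystem (n m p r : ℕ) where
  A : Matrix (Fin n) (Fin n) ℝ
  B : Matrix (Fin n) (Fin m) ℝ
  C : Matrix (Fin p) (Fin n) ℝ
  D : Matrix (Fin p) (Fin m) ℝ
  K : Matrix (Fin r) (Fin n) ℝ

/-- Data of an estimator `ẇ = N w + H u + L y`, `ẑ = R w` of order `q`. -/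
structure LTIEstimator (q m p r : ℕ) where
  N : Matrix (Fin q) (Fin q) ℝ
  H : Matrix (Fin q) (Fin m) ℝ
  L : Matrix (Fin q) (Fin p) ℝ
  R : Matrix (Fin r) (Fin q) ℝ

/-- `f` is locally absolutely continuous on `ℝ`: absolutely continuous on each compact interval. -/
def LocallyAC {k : ℕ} (f : ℝ → Fin k → ℝ) : Prop :=
  ∀ a b : ℝ, AbsolutelyContinuousOnInterval f a b

/-- `f(t) → 0` as `t → ∞` in the essential sense: `lim_{t → ∞} ess sup_{s ≥ t} ‖f(s)‖ = 0`, with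
the Euclidean norm. The essential supremum is taken in `[0, ∞]`. -/
def EssTendstoZero {k : ℕ} (f : ℝ → Fin k → ℝ) : Prop :=
  Tendsto (fun t : ℝ => essSup (fun s => ‖WithLp.toLp 2 (f s)‖ₑ) (volume.restrict (Set.Ici t)))
    atTop (𝓝 0)

/-- `(x, u, y, z)` is a locally integrable solution of the system: `x` is locally absolutely
continuous and the equations hold at almost every time in `ℝ`. -/
structure LTISystem.IsSolution {n m p r : ℕ} (S : LTISystem n m p r)
    (x : ℝ → Fin n → ℝ) (u : ℝ → Fin m → ℝ) (y : ℝ → Fin p → ℝ) (z : ℝ → Fin r → ℝ) : Prop where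
  locInt_x : LocallyIntegrable x volume
  locInt_u : LocallyIntegrable u volume
  locInt_y : LocallyIntegrable y volume
  locInt_z : LocallyIntegrable z volume
  locAC_x : LocallyAC x
  state_eq : ∀ᵐ t : ℝ, HasDerivAt x (S.A *ᵥ x t + S.B *ᵥ u t) t
  output_eq : ∀ᵐ t : ℝ, y t = S.C *ᵥ x t + S.D *ᵥ u t
  functional_eq : ∀ᵐ t : ℝ, z t = S.K *ᵥ x t

/-- `(w, (u, y), ẑ)` is a locally integrable solution of the estimator. -/
structure LTIEstimator.IsSolution {q m p r : ℕ} (E : LTIEstimator q m p r)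
    (w : ℝ → Fin q → ℝ) (u : ℝ → Fin m → ℝ) (y : ℝ → Fin p → ℝ) (zhat : ℝ → Fin r → ℝ) :
    Prop where
  locInt_w : LocallyIntegrable w volume
  locInt_u : LocallyIntegrable u volume
  locInt_y : LocallyIntegrable y volume
  locInt_zhat : LocallyIntegrable zhat volume
  locAC_w : LocallyAC w
  state_eq : ∀ᵐ t : ℝ, HasDerivAt w (E.N *ᵥ w t + E.H *ᵥ u t + E.L *ᵥ y t) t
  output_eq : ∀ᵐ t : ℝ, zhat t = E.R *ᵥ w t

/-- Partial detectability of `(A, C)` with respect to `K`: any two solutions with the same input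
and the same output have asymptotically equal functionals `z`. -/
def LTISystem.PartiallyDetectable {n m p r : ℕ} (S : LTISystem n m p r) : Prop :=
  ∀ (x₁ x₂ : ℝ → Fin n → ℝ) (u : ℝ → Fin m → ℝ) (y : ℝ → Fin p → ℝ) (z₁ z₂ : ℝ → Fin r → ℝ),
    S.IsSolution x₁ u y z₁ → S.IsSolution x₂ u y z₂ → EssTendstoZero (fun t => z₁ t - z₂ t)

/-- `E` is a partial state estimator for `S`: the estimation error tends to zero for every
solution of `S` and every solution of `E` that is driven by the input and output of it. -/
def LTIEstimator.IsPartialStateEstimatorFor {q n m p r : ℕ} (E : LTIEstimator q m p r)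
    (S : LTISystem n m p r) : Prop :=
  ∀ (x : ℝ → Fin n → ℝ) (u : ℝ → Fin m → ℝ) (y : ℝ → Fin p → ℝ) (z : ℝ → Fin r → ℝ)
    (w : ℝ → Fin q → ℝ) (zhat : ℝ → Fin r → ℝ),
    S.IsSolution x u y z → E.IsSolution w u y zhat → EssTendstoZero (fun t => zhat t - z t)

/-- A real square matrix is stable if all its complex eigenvalues have negative real part. -/
def IsStableMatrix {q : ℕ} (N : Matrix (Fin q) (Fin q) ℝ) : Prop :=
  ∀ μ ∈ spectrum ℂ (N.map Complex.ofReal), μ.re < 0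

/-- The estimator built from `T` and `L`:
`N = (T A - L C) Tᵀ`, `H = T B - L D`, `R = K Tᵀ`. -/
def LTISystem.estimatorOf {q n m p r : ℕ} (S : LTISystem n m p r)
    (T : Matrix (Fin q) (Fin n) ℝ) (L : Matrix (Fin q) (Fin p) ℝ) : LTIEstimator q m p r where
  N := (T * S.A - L * S.C) * Tᵀ
  H := T * S.B - L * S.D
  L := L
  R := S.K * Tᵀ

/-- The conditions on `T` and `L`: with `N = (T A - L C) Tᵀ`, the matrix `N` is stable,
`N T + L C = T A` and `K Tᵀ T = K`. -/
def LTISystem.IsDesign {q n m p r : ℕ} (S : LTISystem n m p r)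
    (T : Matrix (Fin q) (Fin n) ℝ) (L : Matrix (Fin q) (Fin p) ℝ) : Prop :=
  IsStableMatrix ((T * S.A - L * S.C) * Tᵀ) ∧
    ((T * S.A - L * S.C) * Tᵀ) * T + L * S.C = T * S.A ∧
    S.K * Tᵀ * T = S.K

/-! Let `W` be the space of row vectors `l` such that `l exp(tA) x` tends to zero for every
unobservable `x`. It contains the rows of `C`, which vanish along such trajectories, and the rows of
`K`, by partial detectability. It is also invariant under `l ↦ l A`. Take for the rows of `T` an
orthonormal basis of `W`: then `Tᵀ T` is the orthogonal projection onto `W`, so `T A`, `C` and `K`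
are all unchanged by right multiplication with `Tᵀ T`. Hence `T` maps trajectories of `A` to
trajectories of `T A Tᵀ`, and the pair `(T A Tᵀ, C Tᵀ)` is detectable in the ordinary sense. A
stabilizing output injection `L` for it completes the design
(`PartiallyDetectable.exists_isDesign`).

The injection comes from duality instead of a canonical form (`exists_lyapunov_or_dual`). Either `P
A + Aᵀ P - σ Cᵀ C` is negative definite for some `P > 0`, and `L = (σ/2) P⁻¹ Cᵀ` stabilizes, or
there is `X ≥ 0`, `X ≠ 0`, with `A X + X Aᵀ ≥ 0` and `X Cᵀ = 0`. Detectability excludes such an `X`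
(`dual_certificate_eq_zero`). With an empty `C` the same alternative gives Lyapunov's theorem for
stable matrices.

For any design, the error `e = w - T x` satisfies `ė = N e`, and `ẑ - z = K Tᵀ e` almost everywhere
because `K Tᵀ T = K`. -/

namespace Matrix

/-! ### The matrix exponential and intertwining relations. -/

section Flow

open scoped Matrix.Norms.Operator

variable {n : ℕ}

/-- The flow `t ↦ exp (t A)` of the linear differential equation `ẋ = A x`. -/
noncomputable def flow (A : Matrix (Fin n) (Fin n) ℝ) (t : ℝ) : Matrix (Fin n) (Fin n) ℝ :=
  NormedSpace.exp (t • A)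

@[simp]
theorem flow_zero (A : Matrix (Fin n) (Fin n) ℝ) : flow A 0 = 1 := by
  simp [flow, NormedSpace.exp_zero]

theorem flow_add (A : Matrix (Fin n) (Fin n) ℝ) (s t : ℝ) :
    flow A (s + t) = flow A s * flow A t := by
  rw [flow, add_smul]
  exact Matrix.exp_add_of_commute _ _ (((Commute.refl A).smul_left s).smul_right t)

theorem flow_transpose (A : Matrix (Fin n) (Fin n) ℝ) (t : ℝ) : flow Aᵀ t = (flow A t)ᵀ := by
  rw [flow, flow, ← Matrix.exp_transpose, Matrix.transpose_smul]

theorem hasDerivAt_flow_mulVec (A : Matrix (Fin n) (Fin n) ℝ) (x : Fin n → ℝ) (t : ℝ) :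
    HasDerivAt (fun t => flow A t *ᵥ x) (A *ᵥ (flow A t *ᵥ x)) t := by
  have h := hasDerivAt_exp_smul_const' (𝕂 := ℝ) A t
  let φ : Matrix (Fin n) (Fin n) ℝ →ₗ[ℝ] (Fin n → ℝ) := (Matrix.mulVecBilin ℝ ℝ).flip x
  have h2 := (LinearMap.toContinuousLinearMap φ).hasFDerivAt.comp_hasDerivAt t h
  rw [Matrix.mulVec_mulVec]
  exact h2

theorem continuous_flow_mulVec (A : Matrix (Fin n) (Fin n) ℝ) (x : Fin n → ℝ) :
    Continuous fun t => flow A t *ᵥ x :=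
  continuous_iff_continuousAt.2 fun t => (hasDerivAt_flow_mulVec A x t).continuousAt

theorem hasDerivAt_vecMul_flow_zero (A : Matrix (Fin n) (Fin n) ℝ) (l : Fin n → ℝ) :
    HasDerivAt (fun t => l ᵥ* flow A t) (l ᵥ* A) 0 := by
  have h := hasDerivAt_flow_mulVec Aᵀ l 0
  simpa [flow_transpose, Matrix.mulVec_transpose] using h

theorem hasSum_flow_mulVec (A : Matrix (Fin n) (Fin n) ℝ) (x : Fin n → ℝ) (t : ℝ) :
    HasSum (fun k : ℕ => ((k.factorial : ℝ)⁻¹ * t ^ k) • (A ^ k *ᵥ x)) (flow A t *ᵥ x) := by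
  have h := NormedSpace.exp_series_hasSum_exp' (𝕂 := ℝ) (t • A)
  let φ : Matrix (Fin n) (Fin n) ℝ →ₗ[ℝ] (Fin n → ℝ) := (Matrix.mulVecBilin ℝ ℝ).flip x
  have h2 := (LinearMap.toContinuousLinearMap φ).hasSum h
  have e : (fun k : ℕ => ((k.factorial : ℝ)⁻¹ * t ^ k) • (A ^ k *ᵥ x)) =
      fun k : ℕ => ((k.factorial : ℝ)⁻¹ • (t • A) ^ k) *ᵥ x := by
    funext k
    rw [smul_pow, smul_smul, Matrix.smul_mulVec]
  rw [e]
  exact h2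

theorem mulVec_flow_mulVec_eq_zero {p : ℕ} {A : Matrix (Fin n) (Fin n) ℝ}
    {C : Matrix (Fin p) (Fin n) ℝ} {x : Fin n → ℝ} (h : ∀ k : ℕ, C *ᵥ (A ^ k *ᵥ x) = 0) (t : ℝ) :
    C *ᵥ (flow A t *ᵥ x) = 0 := by
  have h2 := (LinearMap.toContinuousLinearMap C.mulVecLin).hasSum (hasSum_flow_mulVec A x t)
  refine h2.unique ?_
  convert hasSum_zero with k
  simp [h k]

theorem mul_pow_eq_pow_mul {q : ℕ} {A : Matrix (Fin n) (Fin n) ℝ} {B : Matrix (Fin q) (Fin q) ℝ}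
    {T : Matrix (Fin q) (Fin n) ℝ} (h : T * A = B * T) (k : ℕ) : T * A ^ k = B ^ k * T := by
  induction k with
  | zero => simp
  | succ k ih => rw [pow_succ, pow_succ, ← Matrix.mul_assoc, ih, Matrix.mul_assoc, h,
      Matrix.mul_assoc]

/-- The intertwining relation passes to powers and hence termwise to the exponential series. It
serves to transport trajectories to the reduced system with `B = T A Tᵀ`. -/
theorem mulVec_flow_mulVec_eq {q : ℕ} {A : Matrix (Fin n) (Fin n) ℝ} {B : Matrix (Fin q) (Fin q) ℝ}
    {T : Matrix (Fin q) (Fin n) ℝ} (h : T * A = B * T) (t : ℝ) (x : Fin n → ℝ) :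
    T *ᵥ (flow A t *ᵥ x) = flow B t *ᵥ (T *ᵥ x) := by
  have h1 := (LinearMap.toContinuousLinearMap T.mulVecLin).hasSum (hasSum_flow_mulVec A x t)
  have e : (fun k : ℕ => ((k.factorial : ℝ)⁻¹ * t ^ k) • (B ^ k *ᵥ (T *ᵥ x))) =
      fun k : ℕ => T *ᵥ (((k.factorial : ℝ)⁻¹ * t ^ k) • (A ^ k *ᵥ x)) := by
    funext k
    rw [Matrix.mulVec_smul, Matrix.mulVec_mulVec, Matrix.mulVec_mulVec, mul_pow_eq_pow_mul h]
  have h2 := hasSum_flow_mulVec B (T *ᵥ x) t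
  rw [e] at h2
  exact h1.unique h2

end Flow

/-! ### Quadratic forms along trajectories; orthonormal bases as matrices. -/

section Quadratic

variable {n : ℕ}

theorem hasDerivAt_dotProduct_mulVec {A P : Matrix (Fin n) (Fin n) ℝ} {x : ℝ → Fin n → ℝ} {t : ℝ}
    (h : HasDerivAt x (A *ᵥ x t) t) :
    HasDerivAt (fun t => x t ⬝ᵥ (P *ᵥ x t)) (x t ⬝ᵥ ((P * A + Aᵀ * P) *ᵥ x t)) t := by
  have h1 : HasDerivAt (fun t => P *ᵥ x t) (P *ᵥ (A *ᵥ x t)) t :=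
    (LinearMap.toContinuousLinearMap P.mulVecLin).hasFDerivAt.comp_hasDerivAt t h
  have h2 : HasDerivAt (fun t => x t ⬝ᵥ (P *ᵥ x t))
      (∑ i, ((A *ᵥ x t) i * (P *ᵥ x t) i + x t i * (P *ᵥ (A *ᵥ x t)) i)) t := by
    simp only [dotProduct]
    exact HasDerivAt.fun_sum fun i _ => (hasDerivAt_pi.1 h i).mul (hasDerivAt_pi.1 h1 i)
  convert h2 using 1
  rw [Finset.sum_add_distrib]
  change _ = (A *ᵥ x t) ⬝ᵥ (P *ᵥ x t) + x t ⬝ᵥ (P *ᵥ (A *ᵥ x t))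
  rw [Matrix.add_mulVec, dotProduct_add, add_comm, ← Matrix.mulVec_mulVec, ← Matrix.mulVec_mulVec,
    Matrix.dotProduct_mulVec (x t) Aᵀ, Matrix.vecMul_transpose]

end Quadratic

/-- The rows are an orthonormal basis of `W` for the Euclidean inner product, so `Tᵀ T` is the
orthogonal projection onto `W`. The detour through `EuclideanSpace` is needed because `Fin n → ℝ`
carries the sup norm. -/
theorem exists_orthonormal_rows {n : ℕ} (W : Submodule ℝ (Fin n → ℝ)) :
    ∃ (q : ℕ) (T : Matrix (Fin q) (Fin n) ℝ), (∀ i, T i ∈ W) ∧ T * Tᵀ = 1 ∧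
      ∀ w ∈ W, w ᵥ* (Tᵀ * T) = w := by
  let e := WithLp.linearEquiv 2 ℝ (Fin n → ℝ)
  let W' : Submodule ℝ (EuclideanSpace ℝ (Fin n)) := W.comap e.toLinearMap
  let b := stdOrthonormalBasis ℝ W'
  refine ⟨_, Matrix.of fun i => e (b i : EuclideanSpace ℝ (Fin n)), fun i => (b i).2, ?_, ?_⟩
  · ext i j
    have := b.inner_eq_ite i j
    rw [Matrix.mul_apply, Matrix.one_apply, ← this, Submodule.coe_inner, PiLp.inner_apply]
    exact Finset.sum_congr rfl fun k _ => mul_comm _ _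
  · intro w hw
    let w' : W' := ⟨WithLp.toLp 2 w, hw⟩
    have h := congrArg (fun v : W' => e (v : EuclideanSpace ℝ (Fin n))) (b.sum_repr w')
    simp only [Submodule.coe_sum, Submodule.coe_smul, map_sum, map_smul] at h
    rw [← Matrix.vecMul_vecMul, Matrix.vecMul_eq_sum]
    refine Eq.trans (Finset.sum_congr rfl fun i _ => ?_) h
    congr 1
    rw [b.repr_apply_apply, Submodule.coe_inner, PiLp.inner_apply]
    rfl

end Matrix

/-! ### Duality for the Lyapunov inequality. -/

namespace Matrix

section NegativeDefinite

variable (q : ℕ)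

/-- The square matrices, not necessarily symmetric, whose quadratic form is negative definite. -/
def negDefForm : Set (Matrix (Fin q) (Fin q) ℝ) := {Z | ∀ v : Fin q → ℝ, v ≠ 0 → v ⬝ᵥ (Z *ᵥ v) < 0}

variable {q}

theorem convex_negDefForm : Convex ℝ (negDefForm q) := by
  intro Y hY Z hZ a b ha hb hab v hv
  have h1 := hY v hv
  have h2 := hZ v hv
  rw [Matrix.add_mulVec, Matrix.smul_mulVec, Matrix.smul_mulVec, dotProduct_add, dotProduct_smul,
    dotProduct_smul, smul_eq_mul, smul_eq_mul]
  rcases ha.eq_or_lt with rfl | ha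
  · obtain rfl : b = 1 := by linarith
    linarith
  · nlinarith [mul_pos ha (neg_pos.2 h1), mul_nonneg hb (neg_pos.2 h2).le]

/-- By homogeneity negativity need only be tested on the unit sphere, and compactness of the sphere
makes it an open condition. -/
theorem isOpen_negDefForm : IsOpen (negDefForm q) := by
  have key : negDefForm q =
      {Z | ∀ v ∈ Metric.sphere (0 : Fin q → ℝ) 1, v ⬝ᵥ (Z *ᵥ v) < 0} := by
    ext Z
    refine ⟨fun h v hv => h v ?_, fun h v hv => ?_⟩
    · rintro rfl
      simp at hv
    · have hpos : 0 < ‖v‖ := norm_pos_iff.2 hv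
      have h2 := h (‖v‖⁻¹ • v) (by simp [norm_smul, hpos.ne'])
      rw [Matrix.mulVec_smul, smul_dotProduct, dotProduct_smul, smul_eq_mul, smul_eq_mul,
        ← mul_assoc] at h2
      by_contra h3
      have : 0 ≤ ‖v‖⁻¹ * ‖v‖⁻¹ * (v ⬝ᵥ (Z *ᵥ v)) := mul_nonneg (by positivity) (not_lt.1 h3)
      linarith
  rw [key, isOpen_iff_mem_nhds]
  intro Z hZ
  refine (isCompact_sphere (0 : Fin q → ℝ) 1).eventually_forall_of_forall_eventually
    (P := fun (Z : Matrix (Fin q) (Fin q) ℝ) v => v ⬝ᵥ (Z *ᵥ v) < 0) fun v hv => ?_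
  have hc : Continuous fun z : Matrix (Fin q) (Fin q) ℝ × (Fin q → ℝ) => z.2 ⬝ᵥ (z.1 *ᵥ z.2) :=
    continuous_snd.dotProduct (continuous_fst.matrix_mulVec continuous_snd)
  exact hc.continuousAt.eventually_lt continuousAt_const (hZ v hv)

/-- These are the test matrices for the separating functional: letting `s` grow forces its quadratic
forms to be nonnegative at `w`. -/
theorem neg_one_sub_smul_vecMulVec_mem_negDefForm (w : Fin q → ℝ) {s : ℝ} (hs : 0 ≤ s) :
    -1 - s • vecMulVec w w ∈ negDefForm q := by
  intro v hv
  have h1 : 0 < v ⬝ᵥ v := by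
    simpa using Matrix.dotProduct_star_self_pos_iff.2 hv
  rw [Matrix.sub_mulVec, Matrix.neg_mulVec, Matrix.one_mulVec, Matrix.smul_mulVec,
    Matrix.vecMulVec_mulVec, dotProduct_sub, dotProduct_neg, dotProduct_smul]
  have : v ⬝ᵥ (MulOpposite.op (w ⬝ᵥ v) • w) = (w ⬝ᵥ v) * (w ⬝ᵥ v) := by
    rw [op_smul_eq_smul, dotProduct_smul, smul_eq_mul, dotProduct_comm v w]
  rw [this, smul_eq_mul]
  nlinarith [mul_nonneg hs (mul_self_nonneg (w ⬝ᵥ v))]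

theorem neg_one_mem_negDefForm : (-1 : Matrix (Fin q) (Fin q) ℝ) ∈ negDefForm q := by
  simpa using neg_one_sub_smul_vecMulVec_mem_negDefForm (0 : Fin q → ℝ) le_rfl

theorem exists_eq_trace_mul (g : Matrix (Fin q) (Fin q) ℝ →ₗ[ℝ] ℝ) :
    ∃ X : Matrix (Fin q) (Fin q) ℝ, ∀ Z, g Z = (X * Z).trace := by
  refine ⟨Matrix.of fun i j => g (Matrix.single j i 1), fun Z => ?_⟩
  conv_lhs => rw [Matrix.matrix_eq_sum_single Z]
  simp only [map_sum, Matrix.trace, Matrix.diag, Matrix.mul_apply, Matrix.of_apply]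
  rw [Finset.sum_comm]
  refine Finset.sum_congr rfl fun i _ => Finset.sum_congr rfl fun j _ => ?_
  have : Matrix.single j i (Z j i) = Z j i • Matrix.single j i (1 : ℝ) := by
    simp [Matrix.smul_single]
  rw [this, map_smul, smul_eq_mul, mul_comm]

end NegativeDefinite

theorem PosSemidef.exists_eq_transpose_mul_self {q : ℕ} {X : Matrix (Fin q) (Fin q) ℝ}
    (hX : X.PosSemidef) : ∃ Y : Matrix (Fin q) (Fin q) ℝ, X = Yᵀ * Y := by
  open scoped MatrixOrder in
  obtain ⟨Y, hY⟩ := CStarAlgebra.nonneg_iff_eq_star_mul_self.mp hX.nonneg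
  exact ⟨Y, hY⟩

theorem transpose_mul_self_mul_eq_zero_iff {q r k : ℕ} (Y : Matrix (Fin q) (Fin r) ℝ)
    (M : Matrix (Fin r) (Fin k) ℝ) : Yᵀ * Y * M = 0 ↔ Y * M = 0 := by
  simpa using Matrix.conjTranspose_mul_self_mul_eq_zero Y M

/-- For `X = Yᵀ Y` the trace is the squared Frobenius norm of `Y Cᵀ`. -/
theorem PosSemidef.mul_eq_zero_of_trace_eq_zero {q p : ℕ} {X : Matrix (Fin q) (Fin q) ℝ}
    (hX : X.PosSemidef) {C : Matrix (Fin p) (Fin q) ℝ} (h : (X * (Cᵀ * C)).trace = 0) :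
    X * Cᵀ = 0 := by
  obtain ⟨Y, rfl⟩ := hX.exists_eq_transpose_mul_self
  rw [transpose_mul_self_mul_eq_zero_iff]
  refine Matrix.trace_conjTranspose_mul_self_eq_zero_iff.1 ?_
  rw [Matrix.conjTranspose_eq_transpose_of_trivial, Matrix.transpose_mul, Matrix.transpose_transpose,
    ← h, Matrix.mul_assoc, Matrix.trace_mul_comm, ← Matrix.mul_assoc, ← Matrix.mul_assoc]

theorem eq_zero_of_forall_le_mul {u c : ℝ} (h : ∀ s : ℝ, u ≤ s * c) : c = 0 := by
  by_contra hc
  have := h ((u - 1) / c)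
  rw [div_mul_cancel₀ _ hc] at this
  linarith

theorem nonneg_of_forall_sub_mul_neg {a b : ℝ} (h : ∀ s : ℝ, 0 ≤ s → a - s * b < 0) : 0 ≤ b := by
  by_contra hb
  push Not at hb
  have := h (|a| / (-b)) (div_nonneg (abs_nonneg a) (by linarith))
  have e : |a| / (-b) * b = -|a| := by
    rw [div_mul_eq_mul_div, div_neg, mul_div_cancel_right₀ _ hb.ne]
  rw [e] at this
  linarith [neg_abs_le a]

theorem trace_mul_vecMulVec_self {q : ℕ} (X : Matrix (Fin q) (Fin q) ℝ) (v : Fin q → ℝ) :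
    (X * vecMulVec v v).trace = v ⬝ᵥ (X *ᵥ v) := by
  rw [Matrix.mul_vecMulVec, Matrix.trace_vecMulVec, dotProduct_comm]

theorem trace_transpose_mul' {q : ℕ} (X Z : Matrix (Fin q) (Fin q) ℝ) :
    (Xᵀ * Z).trace = (X * Zᵀ).trace := by
  rw [← Matrix.trace_transpose, Matrix.transpose_mul, Matrix.transpose_transpose,
    Matrix.trace_mul_comm]

theorem isHermitian_add_transpose {q : ℕ} (X : Matrix (Fin q) (Fin q) ℝ) :
    (X + Xᵀ).IsHermitian := by
  rw [Matrix.IsHermitian, Matrix.conjTranspose_eq_transpose_of_trivial, Matrix.transpose_add,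
    Matrix.transpose_transpose, add_comm]

theorem posSemidef_add_transpose {q : ℕ} {X : Matrix (Fin q) (Fin q) ℝ}
    (hX : ∀ v, 0 ≤ v ⬝ᵥ (X *ᵥ v)) : (X + Xᵀ).PosSemidef := by
  refine Matrix.PosSemidef.of_dotProduct_mulVec_nonneg (isHermitian_add_transpose X) fun v => ?_
  have e : v ⬝ᵥ (Xᵀ *ᵥ v) = v ⬝ᵥ (X *ᵥ v) := by
    rw [Matrix.mulVec_transpose, dotProduct_comm, Matrix.dotProduct_mulVec]
  rw [star_trivial, Matrix.add_mulVec, dotProduct_add, e]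
  linarith [hX v]

/-- The operators `X ↦ A X + X Aᵀ` and `P ↦ P A + Aᵀ P` are adjoint for the trace pairing. The
symmetrizations allow `X` and `P` to range over all matrices. -/
theorem trace_lyapunov_mul {q : ℕ} (A X P : Matrix (Fin q) (Fin q) ℝ) :
    ((A * (X + Xᵀ) + (X + Xᵀ) * Aᵀ) * P).trace =
      (X * ((P + Pᵀ) * A + Aᵀ * (P + Pᵀ))).trace := by
  have e : ((A * (X + Xᵀ) + (X + Xᵀ) * Aᵀ) * P).trace =
      ((X + Xᵀ) * (P * A + Aᵀ * P)).trace := by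
    rw [Matrix.add_mul, Matrix.trace_add, Matrix.mul_assoc, Matrix.trace_mul_comm A,
      Matrix.mul_add, Matrix.trace_add, Matrix.mul_assoc, Matrix.mul_assoc]
  rw [e, Matrix.add_mul, Matrix.trace_add, trace_transpose_mul', ← Matrix.trace_add,
    ← Matrix.mul_add]
  congr 2
  simp only [Matrix.transpose_add, Matrix.transpose_mul, Matrix.transpose_transpose,
    Matrix.add_mul, Matrix.mul_add]
  abel

/-- An open convex set disjoint from the range of a linear map lies strictly on the negative side
of a continuous functional that vanishes on this range. -/
theorem exists_neg_on_and_vanishes_on_range {E F : Type*} [AddCommGroup E] [Module ℝ E]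
    [TopologicalSpace E] [IsTopologicalAddGroup E] [ContinuousSMul ℝ E] [AddCommGroup F]
    [Module ℝ F] {s : Set E} (hs : Convex ℝ s) (hs' : IsOpen s) (Φ : F →ₗ[ℝ] E)
    (h : ∀ b, Φ b ∉ s) : ∃ f : E →ₗ[ℝ] ℝ, (∀ a ∈ s, f a < 0) ∧ ∀ b, f (Φ b) = 0 := by
  have hdisj : Disjoint s (LinearMap.range Φ : Set E) := by
    rw [Set.disjoint_right]
    rintro _ ⟨b, rfl⟩
    exact h b
  obtain ⟨f, u, hf, hfΦ⟩ := geometric_hahn_banach_open hs hs' (LinearMap.range Φ).convex hdisj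
  have hu : u ≤ 0 := by simpa using hfΦ 0 (zero_mem _)
  exact ⟨f.toLinearMap, fun a ha => (hf a ha).trans_le hu, fun b =>
    eq_zero_of_forall_le_mul (u := u) fun s => by simpa using hfΦ (Φ (s • b)) ⟨_, rfl⟩⟩

/-- The linear map sending `(P, σ)` to the pair of matrices that have to be negative definite for
the symmetrization of `P` to be a Lyapunov certificate of detectability. -/
def lyapunovMap {q p : ℕ} (A : Matrix (Fin q) (Fin q) ℝ) (C : Matrix (Fin p) (Fin q) ℝ) :
    Matrix (Fin q) (Fin q) ℝ × ℝ →ₗ[ℝ] Matrix (Fin q) (Fin q) ℝ × Matrix (Fin q) (Fin q) ℝ where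
  toFun b := (-(b.1 + b.1ᵀ), (b.1 + b.1ᵀ) * A + Aᵀ * (b.1 + b.1ᵀ) - b.2 • (Cᵀ * C))
  map_add' b c := by
    ext1
    · simp only [Prod.fst_add, Matrix.transpose_add]
      abel
    · simp only [Prod.fst_add, Prod.snd_add, Matrix.transpose_add, Matrix.add_mul, Matrix.mul_add,
        add_smul]
      abel
  map_smul' s b := by
    ext1
    · simp [smul_add]
    · simp [smul_add, smul_sub, Matrix.add_mul, Matrix.mul_add, smul_smul]

/-- If no quadratic Lyapunov certificate of detectability exists, then a linear functional on pairs
of matrices separates the candidates from the pairs of negative definite forms. -/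
theorem exists_separating_trace_forms {q p : ℕ} {A : Matrix (Fin q) (Fin q) ℝ}
    {C : Matrix (Fin p) (Fin q) ℝ}
    (hno : ¬ ∃ (P : Matrix (Fin q) (Fin q) ℝ) (σ : ℝ), P.PosDef ∧
      P * A + Aᵀ * P - σ • (Cᵀ * C) ∈ negDefForm q) :
    ∃ X₁ X₂ : Matrix (Fin q) (Fin q) ℝ,
      (∀ Y ∈ negDefForm q, ∀ Z ∈ negDefForm q, (X₁ * Y).trace + (X₂ * Z).trace < 0) ∧
      ∀ (P : Matrix (Fin q) (Fin q) ℝ) (σ : ℝ), (X₁ * (-(P + Pᵀ))).trace +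
        (X₂ * ((P + Pᵀ) * A + Aᵀ * (P + Pᵀ) - σ • (Cᵀ * C))).trace = 0 := by
  have hconv : Convex ℝ (negDefForm q ×ˢ negDefForm q) :=
    convex_negDefForm.prod convex_negDefForm
  have hopen : IsOpen (negDefForm q ×ˢ negDefForm q) := isOpen_negDefForm.prod isOpen_negDefForm
  have hdisj : ∀ b, lyapunovMap A C b ∉ negDefForm q ×ˢ negDefForm q := by
      rintro ⟨P, σ⟩ ⟨h1, h2⟩
      refine hno ⟨P + Pᵀ, σ, Matrix.PosDef.of_dotProduct_mulVec_pos
        (isHermitian_add_transpose P) fun v hv => ?_, h2⟩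
      have h3 : v ⬝ᵥ (-(P + Pᵀ) *ᵥ v) < 0 := h1 v hv
      rw [Matrix.neg_mulVec, dotProduct_neg] at h3
      rw [star_trivial]
      linarith
  obtain ⟨f, hfO, hfΦ⟩ := exists_neg_on_and_vanishes_on_range hconv hopen (lyapunovMap A C) hdisj
  obtain ⟨X₁, hX₁⟩ := exists_eq_trace_mul (f ∘ₗ LinearMap.inl ℝ _ _)
  obtain ⟨X₂, hX₂⟩ := exists_eq_trace_mul (f ∘ₗ LinearMap.inr ℝ _ _)
  have hf : ∀ Y Z : Matrix (Fin q) (Fin q) ℝ, f (Y, Z) = (X₁ * Y).trace + (X₂ * Z).trace := by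
    intro Y Z
    rw [← hX₁, ← hX₂, LinearMap.comp_apply, LinearMap.comp_apply, LinearMap.inl_apply,
      LinearMap.inr_apply, ← map_add, Prod.mk_add_mk, add_zero, zero_add]
  refine ⟨X₁, X₂, fun Y hY Z hZ => ?_, fun P σ => ?_⟩
  · rw [← hf]
    exact hfO _ ⟨hY, hZ⟩
  · rw [← hf]
    exact hfΦ (P, σ)

/-- A theorem of alternatives: either the pair `(A, C)` admits a quadratic Lyapunov certificate of
detectability, or there is a nonzero positive semidefinite dual certificate. -/
theorem exists_lyapunov_or_dual {q p : ℕ} (A : Matrix (Fin q) (Fin q) ℝ)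
    (C : Matrix (Fin p) (Fin q) ℝ) :
    (∃ (P : Matrix (Fin q) (Fin q) ℝ) (σ : ℝ), P.PosDef ∧
      P * A + Aᵀ * P - σ • (Cᵀ * C) ∈ negDefForm q) ∨
    ∃ X : Matrix (Fin q) (Fin q) ℝ, X ≠ 0 ∧ X.PosSemidef ∧ (A * X + X * Aᵀ).PosSemidef ∧
      X * Cᵀ = 0 := by
  refine or_iff_not_imp_left.2 fun hno => ?_
  obtain ⟨X₁, X₂, hneg, hzero⟩ := exists_separating_trace_forms hno
  have htr : -X₁.trace - X₂.trace < 0 := by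
    have := hneg _ neg_one_mem_negDefForm _ neg_one_mem_negDefForm
    simpa [sub_eq_add_neg] using this
  have hq₁ : ∀ v, 0 ≤ v ⬝ᵥ (X₁ *ᵥ v) := fun v =>
    nonneg_of_forall_sub_mul_neg (a := -X₁.trace - X₂.trace) fun s hs => by
      have := hneg _ (neg_one_sub_smul_vecMulVec_mem_negDefForm v hs) _ neg_one_mem_negDefForm
      rw [Matrix.mul_sub, Matrix.trace_sub, Matrix.mul_smul, Matrix.trace_smul,
        trace_mul_vecMulVec_self] at this
      simp only [mul_neg, mul_one, Matrix.trace_neg, smul_eq_mul] at this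
      linarith
  have hq₂ : ∀ v, 0 ≤ v ⬝ᵥ (X₂ *ᵥ v) := fun v =>
    nonneg_of_forall_sub_mul_neg (a := -X₁.trace - X₂.trace) fun s hs => by
      have := hneg _ neg_one_mem_negDefForm _ (neg_one_sub_smul_vecMulVec_mem_negDefForm v hs)
      rw [Matrix.mul_sub, Matrix.trace_sub, Matrix.mul_smul, Matrix.trace_smul,
        trace_mul_vecMulVec_self] at this
      simp only [mul_neg, mul_one, Matrix.trace_neg, smul_eq_mul] at this
      linarith
  -- As `P` is arbitrary, nondegeneracy of the trace pairing turns the vanishing of the functional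
  -- into a matrix identity.
  have hly : A * (X₂ + X₂ᵀ) + (X₂ + X₂ᵀ) * Aᵀ = X₁ + X₁ᵀ := by
    refine Matrix.ext_iff_trace_mul_right.2 fun P => ?_
    have h := hzero P 0
    rw [zero_smul, sub_zero, Matrix.mul_neg, Matrix.trace_neg] at h
    rw [trace_lyapunov_mul, Matrix.add_mul X₁, Matrix.trace_add, trace_transpose_mul',
      ← Matrix.trace_add, ← Matrix.mul_add]
    linarith
  have hX : (X₂ + X₂ᵀ).PosSemidef := posSemidef_add_transpose hq₂
  refine ⟨X₂ + X₂ᵀ, fun h0 => ?_, hX, hly ▸ posSemidef_add_transpose hq₁,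
    hX.mul_eq_zero_of_trace_eq_zero ?_⟩
  -- If the certificate vanished, `X₁` and `X₂` would both have trace zero, contradicting `htr`.
  · have h1 : X₁ + X₁ᵀ = 0 := by rw [← hly, h0]; simp
    have h2 := congrArg Matrix.trace h0
    have h3 := congrArg Matrix.trace h1
    simp only [Matrix.trace_add, Matrix.trace_transpose, Matrix.trace_zero] at h2 h3
    linarith
  -- Here `σ` varies while `P = 0`. Since `σ` has no sign constraint, an equality results.
  · have h : (X₂ * (Cᵀ * C)).trace = 0 := by simpa using hzero 0 1
    rw [Matrix.add_mul, Matrix.trace_add, trace_transpose_mul', Matrix.transpose_mul,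
      Matrix.transpose_transpose, h, add_zero]

end Matrix

/-! ### Stability and Lyapunov inequalities. -/

namespace Matrix

theorem re_map_ofReal_mulVec {m n : ℕ} (M : Matrix (Fin m) (Fin n) ℝ) (v : Fin n → ℂ) (i : Fin m) :
    ((M.map Complex.ofReal *ᵥ v) i).re = (M *ᵥ fun j => (v j).re) i := by
  simp [Matrix.mulVec, dotProduct]

theorem im_map_ofReal_mulVec {m n : ℕ} (M : Matrix (Fin m) (Fin n) ℝ) (v : Fin n → ℂ) (i : Fin m) :
    ((M.map Complex.ofReal *ᵥ v) i).im = (M *ᵥ fun j => (v j).im) i := by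
  simp [Matrix.mulVec, dotProduct]

theorem mulVec_re_im_of_eigenvector {q : ℕ} {N : Matrix (Fin q) (Fin q) ℝ} {v : Fin q → ℂ} {μ : ℂ}
    (h : N.map Complex.ofReal *ᵥ v = μ • v) :
    (N *ᵥ fun j => (v j).re) = μ.re • (fun j => (v j).re) - μ.im • (fun j => (v j).im) ∧
    (N *ᵥ fun j => (v j).im) = μ.im • (fun j => (v j).re) + μ.re • (fun j => (v j).im) := by
  constructor
  · ext i
    rw [← re_map_ofReal_mulVec, h]
    simp
  · ext i
    rw [← im_map_ofReal_mulVec, h]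
    simp [add_comm]

theorem exists_eigenvector_of_mem_spectrum {q : ℕ} {M : Matrix (Fin q) (Fin q) ℂ} {μ : ℂ}
    (h : μ ∈ spectrum ℂ M) : ∃ v : Fin q → ℂ, v ≠ 0 ∧ M *ᵥ v = μ • v := by
  rw [← Matrix.spectrum_toLin', ← Module.End.hasEigenvalue_iff_mem_spectrum] at h
  obtain ⟨v, hv⟩ := h.exists_hasEigenvector
  exact ⟨v, hv.2, by simpa using hv.apply_eq_smul⟩

theorem mem_spectrum_of_eigenvector {q : ℕ} {M : Matrix (Fin q) (Fin q) ℂ} {μ : ℂ}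
    {v : Fin q → ℂ} (hv : v ≠ 0) (h : M *ᵥ v = μ • v) : μ ∈ spectrum ℂ M := by
  rw [← Matrix.spectrum_toLin', ← Module.End.hasEigenvalue_iff_mem_spectrum]
  exact Module.End.hasEigenvalue_of_hasEigenvector
    (Module.End.hasEigenvector_iff.2 ⟨Module.End.mem_eigenspace_iff.2 (by simpa using h), hv⟩)

theorem dotProduct_mulVec_comm_of_transpose_eq {q : ℕ} {P : Matrix (Fin q) (Fin q) ℝ} (hP : Pᵀ = P)
    (a b : Fin q → ℝ) : a ⬝ᵥ (P *ᵥ b) = b ⬝ᵥ (P *ᵥ a) := by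
  rw [Matrix.dotProduct_mulVec, ← Matrix.mulVec_transpose, hP, dotProduct_comm]

theorem dotProduct_lyapunov_mulVec {q : ℕ} {P : Matrix (Fin q) (Fin q) ℝ} (hP : Pᵀ = P)
    (N : Matrix (Fin q) (Fin q) ℝ) (a : Fin q → ℝ) :
    a ⬝ᵥ ((P * N + Nᵀ * P) *ᵥ a) = 2 * (a ⬝ᵥ (P *ᵥ (N *ᵥ a))) := by
  rw [Matrix.add_mulVec, dotProduct_add, ← Matrix.mulVec_mulVec, ← Matrix.mulVec_mulVec,
    Matrix.dotProduct_mulVec a Nᵀ, Matrix.vecMul_transpose,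
    dotProduct_mulVec_comm_of_transpose_eq hP (N *ᵥ a)]
  ring

/-- For an eigenvector `v = a + i b`, the sum of the Lyapunov form at `a` and at `b` is `2 Re μ`
times the sum of the `P`-forms; the cross terms cancel by symmetry. -/
theorem PosDef.isStableMatrix {q : ℕ} {N P : Matrix (Fin q) (Fin q) ℝ} (hP : P.PosDef)
    (h : P * N + Nᵀ * P ∈ negDefForm q) : IsStableMatrix N := by
  intro μ hμ
  obtain ⟨v, hv, hNv⟩ := exists_eigenvector_of_mem_spectrum hμ
  obtain ⟨h1, h2⟩ := mulVec_re_im_of_eigenvector hNv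
  have hsym : Pᵀ = P := hP.isHermitian
  set a : Fin q → ℝ := fun j => (v j).re
  set b : Fin q → ℝ := fun j => (v j).im
  have hab : a ≠ 0 ∨ b ≠ 0 := by
    by_contra hcon
    push Not at hcon
    exact hv (funext fun j => Complex.ext (congrFun hcon.1 j) (congrFun hcon.2 j))
  have hle : ∀ w, w ⬝ᵥ ((P * N + Nᵀ * P) *ᵥ w) ≤ 0 := fun w => by
    by_cases hw : w = 0
    · simp [hw]
    · exact (h w hw).le
  have hsum : a ⬝ᵥ ((P * N + Nᵀ * P) *ᵥ a) + b ⬝ᵥ ((P * N + Nᵀ * P) *ᵥ b) < 0 := by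
    rcases hab with ha | hb
    · linarith [h a ha, hle b]
    · linarith [h b hb, hle a]
  have e : a ⬝ᵥ ((P * N + Nᵀ * P) *ᵥ a) + b ⬝ᵥ ((P * N + Nᵀ * P) *ᵥ b) =
      2 * (μ.re * (a ⬝ᵥ (P *ᵥ a) + b ⬝ᵥ (P *ᵥ b))) := by
    rw [dotProduct_lyapunov_mulVec hsym, dotProduct_lyapunov_mulVec hsym, h1, h2]
    simp only [Matrix.mulVec_sub, Matrix.mulVec_add, Matrix.mulVec_smul, dotProduct_sub,
      dotProduct_add, dotProduct_smul, smul_eq_mul]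
    rw [dotProduct_mulVec_comm_of_transpose_eq hsym b a]
    ring
  have hnn : ∀ w, 0 ≤ w ⬝ᵥ (P *ᵥ w) := fun w => by
    simpa using hP.posSemidef.dotProduct_mulVec_nonneg w
  by_contra hre
  rw [e] at hsum
  have := mul_nonneg (not_lt.1 hre) (add_nonneg (hnn a) (hnn b))
  linarith

/-- The kernel of a positive semidefinite `X` with `N X + X Nᵀ` positive semidefinite is invariant
under `Nᵀ`. -/
theorem PosSemidef.mulVec_transpose_mulVec_eq_zero {q : ℕ} {N X : Matrix (Fin q) (Fin q) ℝ}
    (hX : X.PosSemidef) (h : (N * X + X * Nᵀ).PosSemidef) {v : Fin q → ℝ} (hv : X *ᵥ v = 0) :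
    X *ᵥ (Nᵀ *ᵥ v) = 0 := by
  have hsym : Xᵀ = X := hX.isHermitian
  have h1 : v ⬝ᵥ ((N * X + X * Nᵀ) *ᵥ v) = 0 := by
    rw [Matrix.add_mulVec, dotProduct_add, ← Matrix.mulVec_mulVec, ← Matrix.mulVec_mulVec, hv,
      dotProduct_mulVec_comm_of_transpose_eq hsym v, hv]
    simp
  have h2 := (h.dotProduct_mulVec_zero_iff v).1 (by simpa using h1)
  rw [Matrix.add_mulVec, ← Matrix.mulVec_mulVec, ← Matrix.mulVec_mulVec, hv] at h2
  simpa using h2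

theorem exists_comp_eq_of_ker_le {V W : Type*} [AddCommGroup V] [Module ℝ V] [AddCommGroup W]
    [Module ℝ W] {f g : V →ₗ[ℝ] W} (h : LinearMap.ker f ≤ LinearMap.ker g) :
    ∃ k : W →ₗ[ℝ] W, k ∘ₗ f = g := by
  obtain ⟨s, hs⟩ := f.rangeRestrict.exists_rightInverse_of_surjective f.range_rangeRestrict
  obtain ⟨k, hk⟩ := (g ∘ₗ s).exists_extend
  refine ⟨k, LinearMap.ext fun v => ?_⟩
  have h1 : k (f v) = g (s (f.rangeRestrict v)) := LinearMap.congr_fun hk (f.rangeRestrict v)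
  have h2 : f (s (f.rangeRestrict v)) = f v :=
    congrArg Subtype.val (LinearMap.congr_fun hs (f.rangeRestrict v))
  have h3 : s (f.rangeRestrict v) - v ∈ LinearMap.ker g :=
    h (by rw [LinearMap.mem_ker, map_sub, h2, sub_self])
  rw [LinearMap.mem_ker, map_sub, sub_eq_zero] at h3
  rw [LinearMap.comp_apply, h1, h3]

/-- The kernel of `X` lies in that of `X Nᵀ`, so `X Nᵀ` factors as `k X`. Transposing shows that the
range of `X` is invariant under `N`. -/
theorem PosSemidef.exists_mul_eq_mul {q : ℕ} {N X : Matrix (Fin q) (Fin q) ℝ}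
    (hX : X.PosSemidef) (h : (N * X + X * Nᵀ).PosSemidef) :
    ∃ G : Matrix (Fin q) (Fin q) ℝ, N * X = X * G := by
  have hker : LinearMap.ker X.mulVecLin ≤ LinearMap.ker (X * Nᵀ).mulVecLin := fun v hv => by
    rw [LinearMap.mem_ker, Matrix.mulVecLin_apply] at hv ⊢
    rw [← Matrix.mulVec_mulVec, hX.mulVec_transpose_mulVec_eq_zero h hv]
  obtain ⟨k, hk⟩ := exists_comp_eq_of_ker_le hker
  refine ⟨(LinearMap.toMatrix' k)ᵀ, ?_⟩
  have e : LinearMap.toMatrix' k * X = X * Nᵀ := by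
    have := congrArg LinearMap.toMatrix' hk
    rwa [LinearMap.toMatrix'_comp, ← Matrix.toLin'_apply', ← Matrix.toLin'_apply',
      LinearMap.toMatrix'_toLin', LinearMap.toMatrix'_toLin'] at this
  have hsym : Xᵀ = X := hX.isHermitian
  have e' := congrArg Matrix.transpose e
  rw [Matrix.transpose_mul, Matrix.transpose_mul, Matrix.transpose_transpose, hsym] at e'
  exact e'.symm

theorem exists_lyapunov_of_isStableMatrix {q : ℕ} {N : Matrix (Fin q) (Fin q) ℝ}
    (hN : IsStableMatrix N) :
    ∃ P : Matrix (Fin q) (Fin q) ℝ, P.PosDef ∧ P * N + Nᵀ * P ∈ negDefForm q := by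
  -- A matrix `C` with no rows removes the output term from the alternative.
  rcases exists_lyapunov_or_dual N (0 : Matrix (Fin 0) (Fin q) ℝ) with ⟨P, σ, hP, h⟩ | ⟨X, h0, hX, h, -⟩
  · exact ⟨P, hP, by simpa using h⟩
  exfalso
  obtain ⟨G, hG⟩ := hX.exists_mul_eq_mul h
  have hsym : Xᵀ = X := hX.isHermitian
  let Xc := X.map Complex.ofReal
  let Nc := N.map Complex.ofReal
  have hGc : Nc * Xc = Xc * G.map Complex.ofReal := by
    have := congrArg (fun M : Matrix (Fin q) (Fin q) ℝ => M.map Complex.ofRealHom) hG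
    rwa [Matrix.map_mul, Matrix.map_mul] at this
  have hmaps : ∀ y ∈ LinearMap.range Xc.mulVecLin, Nc.mulVecLin y ∈ LinearMap.range Xc.mulVecLin := by
    rintro _ ⟨w, rfl⟩
    refine ⟨G.map Complex.ofReal *ᵥ w, ?_⟩
    simp only [Matrix.mulVecLin_apply, Matrix.mulVec_mulVec, hGc]
  have hnt : Nontrivial (LinearMap.range Xc.mulVecLin) := by
    rw [Submodule.nontrivial_iff_ne_bot, Ne, LinearMap.range_eq_bot]
    intro hz
    refine h0 (Matrix.ext fun i j => ?_)
    have := congrFun (LinearMap.congr_fun hz (Pi.single j 1)) i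
    simpa [Xc] using this
  -- The complexified range of `X` is nonzero and `N`-invariant, so it contains an eigenvector `X w`
  -- of `N`.
  obtain ⟨μ, hμ⟩ := Module.End.exists_eigenvalue (Nc.mulVecLin.restrict hmaps)
  obtain ⟨⟨_, w, rfl⟩, hw⟩ := hμ.exists_hasEigenvector
  have hne : Xc *ᵥ w ≠ 0 := fun hz => hw.2 (Subtype.ext hz)
  have heig : Nc *ᵥ (Xc *ᵥ w) = μ • (Xc *ᵥ w) := congrArg Subtype.val hw.apply_eq_smul
  have hre := hN μ (mem_spectrum_of_eigenvector hne heig)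
  obtain ⟨h1, h2⟩ := mulVec_re_im_of_eigenvector heig
  simp only [Xc, re_map_ofReal_mulVec, im_map_ofReal_mulVec] at h1 h2
  change N *ᵥ (X *ᵥ _) = _ • (X *ᵥ _) - _ • (X *ᵥ _) at h1
  change N *ᵥ (X *ᵥ _) = _ • (X *ᵥ _) + _ • (X *ᵥ _) at h2
  set c : Fin q → ℝ := fun j => (w j).re
  set d : Fin q → ℝ := fun j => (w j).im
  have hnn : ∀ v, 0 ≤ v ⬝ᵥ (X *ᵥ v) := fun v => by
    simpa using hX.dotProduct_mulVec_nonneg v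
  have hly : ∀ v, 0 ≤ v ⬝ᵥ (N *ᵥ (X *ᵥ v)) := fun v => by
    have h3 := h.dotProduct_mulVec_nonneg v
    rw [star_trivial, Matrix.add_mulVec, dotProduct_add, ← Matrix.mulVec_mulVec,
      ← Matrix.mulVec_mulVec, dotProduct_mulVec_comm_of_transpose_eq hsym v, dotProduct_comm _ (X *ᵥ v),
      Matrix.dotProduct_mulVec (X *ᵥ v), Matrix.vecMul_transpose, dotProduct_comm _ v] at h3
    linarith
  -- With `w = c + i d`, this nonnegative sum equals `Re μ` times `cᵀ X c + dᵀ X d`. As `Re μ < 0`,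
  -- both forms vanish, so `X w = 0`.
  have hsum := add_nonneg (hly c) (hly d)
  rw [h1, h2] at hsum
  simp only [dotProduct_sub, dotProduct_add, dotProduct_smul, smul_eq_mul] at hsum
  rw [dotProduct_mulVec_comm_of_transpose_eq hsym d c] at hsum
  have hz : c ⬝ᵥ (X *ᵥ c) + d ⬝ᵥ (X *ᵥ d) ≤ 0 := by
    by_contra hcon
    nlinarith [mul_pos (neg_pos.2 hre) (not_le.1 hcon)]
  have hc : X *ᵥ c = 0 := (hX.dotProduct_mulVec_zero_iff c).1 (by
    rw [star_trivial]
    linarith [hnn c, hnn d])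
  have hd : X *ᵥ d = 0 := (hX.dotProduct_mulVec_zero_iff d).1 (by
    rw [star_trivial]
    linarith [hnn c, hnn d])
  refine hne (funext fun i => Complex.ext ?_ ?_)
  · rw [re_map_ofReal_mulVec]
    exact congrFun hc i
  · rw [im_map_ofReal_mulVec]
    exact congrFun hd i

end Matrix

/-! ### Absolute continuity and essential limits. -/

/-- Subtracting the primitive of `g` leaves an absolutely continuous function with derivative zero
almost everywhere, hence a constant. It upgrades the error equation to a classical one. -/
theorem hasDerivAt_of_locallyAC {k : ℕ} {f g : ℝ → Fin k → ℝ} (hf : LocallyAC f)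
    (hg : Continuous g) (h : ∀ᵐ t : ℝ, HasDerivAt f (g t) t) (t : ℝ) : HasDerivAt f (g t) t := by
  let G : ℝ → Fin k → ℝ := fun t => ∫ s in (0 : ℝ)..t, g s
  have hG : ∀ t, HasDerivAt G (g t) t := fun t => hg.integral_hasStrictDerivAt 0 t |>.hasDerivAt
  have hG1 : ContDiff ℝ 1 G := by
    rw [contDiff_one_iff_deriv]
    refine ⟨fun t => (hG t).differentiableAt, ?_⟩
    rwa [funext fun t => (hG t).deriv]
  obtain ⟨C, hC⟩ := ((hf (t - 1) (t + 1)).fun_sub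
    hG1.contDiffOn.absolutelyContinuousOnInterval).const_of_ae_hasDerivAt_zero (by
      filter_upwards [h] with s hs _
      simpa using hs.fun_sub (hG s))
  have hev : f =ᶠ[𝓝 t] fun s => C + G s := by
    filter_upwards [Icc_mem_nhds (show t - 1 < t by linarith) (show t < t + 1 by linarith)] with s hs
    rw [← hC s (by rwa [Set.uIcc_of_le (by linarith)]), sub_add_cancel]
  exact ((hG t).const_add C).congr_of_eventuallyEq hev

theorem LocallyAC.continuous {k : ℕ} {f : ℝ → Fin k → ℝ} (hf : LocallyAC f) : Continuous f :=
  continuous_iff_continuousAt.2 fun t =>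
    (hf (t - 1) (t + 1)).continuousOn.continuousAt (by
      rw [Set.uIcc_of_le (by linarith)]
      exact Icc_mem_nhds (by linarith) (by linarith))

theorem LipschitzWith.comp_absolutelyContinuousOnInterval {X Y : Type*} [PseudoMetricSpace X]
    [PseudoMetricSpace Y] {K : NNReal} {g : X → Y} (hg : LipschitzWith K g) {f : ℝ → X} {a b : ℝ}
    (hf : AbsolutelyContinuousOnInterval f a b) :
    AbsolutelyContinuousOnInterval (fun t => g (f t)) a b := by
  have h : Tendsto (fun E : ℕ × (ℕ → ℝ × ℝ) =>
      (K : ℝ) * ∑ i ∈ Finset.range E.1, dist (f (E.2 i).1) (f (E.2 i).2)) _ (𝓝 ((K : ℝ) * 0)) :=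
    Tendsto.const_mul (K : ℝ) hf
  rw [mul_zero] at h
  refine squeeze_zero (fun E => Finset.sum_nonneg fun i _ => dist_nonneg) (fun E => ?_) h
  rw [Finset.mul_sum]
  exact Finset.sum_le_sum fun i _ => hg.dist_le_mul _ _

theorem LocallyAC.mulVec {k l : ℕ} {f : ℝ → Fin k → ℝ} (hf : LocallyAC f)
    (M : Matrix (Fin l) (Fin k) ℝ) : LocallyAC fun t => M *ᵥ f t := fun a b =>
  (LinearMap.toContinuousLinearMap M.mulVecLin).lipschitz.comp_absolutelyContinuousOnInterval
    (hf a b)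

theorem LocallyAC.of_contDiff {k : ℕ} {f : ℝ → Fin k → ℝ} (hf : ContDiff ℝ 1 f) : LocallyAC f :=
  fun _ _ => hf.contDiffOn.absolutelyContinuousOnInterval

theorem essTendstoZero_of_tendsto {k : ℕ} {f g : ℝ → Fin k → ℝ} (hg : Tendsto g atTop (𝓝 0))
    (h : f =ᵐ[volume] g) : EssTendstoZero f := by
  have hg' : Tendsto (fun t => ‖WithLp.toLp 2 (g t)‖ₑ) atTop (𝓝 0) := by
    have h1 := (((PiLp.continuous_toLp 2 fun _ : Fin k => ℝ).tendsto 0).comp hg).enorm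
    simpa using h1
  rw [EssTendstoZero, ENNReal.tendsto_nhds_zero]
  intro ε hε
  obtain ⟨a, ha⟩ := eventually_atTop.1 ((ENNReal.tendsto_nhds_zero.1 hg') ε hε)
  filter_upwards [eventually_ge_atTop a] with t ht
  refine essSup_le_of_ae_le _ ?_
  filter_upwards [ae_restrict_of_ae h, ae_restrict_mem measurableSet_Ici] with s hs hst
  rw [hs]
  exact ha s (ht.trans hst)

/-- By continuity, exceeding a bound at one point means exceeding it on a nonempty open set, which
has positive measure. -/
theorem EssTendstoZero.tendsto {k : ℕ} {f : ℝ → Fin k → ℝ} (h : EssTendstoZero f)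
    (hf : Continuous f) : Tendsto f atTop (𝓝 0) := by
  have hc : Continuous fun t => ‖WithLp.toLp 2 (f t)‖ₑ :=
    ((PiLp.continuous_toLp 2 fun _ : Fin k => ℝ).comp hf).enorm
  have h1 : Tendsto (fun t => ‖WithLp.toLp 2 (f t)‖ₑ) atTop (𝓝 0) := by
    rw [ENNReal.tendsto_nhds_zero]
    intro ε hε
    obtain ⟨a, ha⟩ := eventually_atTop.1 ((ENNReal.tendsto_nhds_zero.1 h) ε hε)
    filter_upwards [eventually_gt_atTop a] with t ht
    by_contra hcon
    have hopen : IsOpen ({s | ε < ‖WithLp.toLp 2 (f s)‖ₑ} ∩ Set.Ioi a) :=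
      (isOpen_lt continuous_const hc).inter isOpen_Ioi
    have hpos := hopen.measure_pos volume ⟨t, not_le.1 hcon, ht⟩
    have hae : ∀ᵐ s : ℝ, s ∈ Set.Ici a → ‖WithLp.toLp 2 (f s)‖ₑ ≤ ε := by
      rw [← ae_restrict_iff' measurableSet_Ici]
      filter_upwards [ENNReal.ae_le_essSup (μ := volume.restrict (Set.Ici a))
        fun s => ‖WithLp.toLp 2 (f s)‖ₑ] with s hs
      exact hs.trans (ha a le_rfl)
    refine hpos.ne' (measure_mono_null ?_ (ae_iff.1 hae))
    rintro s ⟨hs1, hs2⟩ hcon2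
    exact absurd (hcon2 (Set.mem_Ioi.1 hs2).le) (not_le.2 hs1)
  have h2 : Tendsto (fun t => WithLp.toLp 2 (f t)) atTop (𝓝 0) := by
    rw [tendsto_zero_iff_norm_tendsto_zero]
    have := (ENNReal.tendsto_toReal ENNReal.zero_ne_top).comp h1
    simpa [Function.comp_def] using this
  have h3 := ((PiLp.continuous_ofLp 2 fun _ : Fin k => ℝ).tendsto 0).comp h2
  exact h3

/-! ### Decay for stable matrices and convergence of the estimator. -/

namespace Matrix

theorem mulVec_continuous {m k : ℕ} (M : Matrix (Fin m) (Fin k) ℝ) :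
    Continuous fun v : Fin k → ℝ => M *ᵥ v :=
  continuous_const.matrix_mulVec continuous_id

/-- Openness of the negative definite forms lets `Q` absorb a small multiple of `P`. This yields
both the decay rate and the coercivity of a Lyapunov function. -/
theorem exists_le_neg_mul_of_mem_negDefForm {q : ℕ} {Q : Matrix (Fin q) (Fin q) ℝ}
    (hQ : Q ∈ negDefForm q) (P : Matrix (Fin q) (Fin q) ℝ) :
    ∃ ε > 0, ∀ v : Fin q → ℝ, v ⬝ᵥ (Q *ᵥ v) ≤ -ε * (v ⬝ᵥ (P *ᵥ v)) := by
  have hopen : ∀ᶠ ε : ℝ in 𝓝 0, Q + ε • P ∈ negDefForm q := by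
    have hc : Continuous fun ε : ℝ => Q + ε • P := by fun_prop
    exact hc.continuousAt.eventually_mem (isOpen_negDefForm.mem_nhds (by simpa using hQ))
  obtain ⟨ε, hε, hmem⟩ := (hopen.filter_mono nhdsWithin_le_nhds).and
    (self_mem_nhdsWithin : Set.Ioi (0 : ℝ) ∈ 𝓝[>] 0) |>.exists
  refine ⟨ε, hmem, fun v => ?_⟩
  by_cases hv : v = 0
  · simp [hv]
  have := hε v hv
  rw [Matrix.add_mulVec, dotProduct_add, Matrix.smul_mulVec, dotProduct_smul, smul_eq_mul] at this
  linarith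

/-- The solutions of `ė = N e` tend to zero if `N` is stable. -/
theorem tendsto_zero_of_isStableMatrix {q : ℕ} {N : Matrix (Fin q) (Fin q) ℝ}
    (hN : IsStableMatrix N) {e : ℝ → Fin q → ℝ} (he : ∀ t, HasDerivAt e (N *ᵥ e t) t) :
    Tendsto e atTop (𝓝 0) := by
  obtain ⟨P, hP, hPN⟩ := exists_lyapunov_of_isStableMatrix hN
  obtain ⟨ε, hε, hdecay⟩ := exists_le_neg_mul_of_mem_negDefForm hPN P
  have hneg : -P ∈ negDefForm q := fun v hv => by
    have : 0 < v ⬝ᵥ (P *ᵥ v) := by simpa using hP.dotProduct_mulVec_pos hv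
    rw [Matrix.neg_mulVec, dotProduct_neg]
    linarith
  obtain ⟨δ, hδ, hcoer⟩ := exists_le_neg_mul_of_mem_negDefForm hneg 1
  let V : ℝ → ℝ := fun t => e t ⬝ᵥ (P *ᵥ e t)
  have hV : ∀ t, HasDerivAt V (e t ⬝ᵥ ((P * N + Nᵀ * P) *ᵥ e t)) t := fun t =>
    hasDerivAt_dotProduct_mulVec (he t)
  have hexp : ∀ t, HasDerivAt (fun t => Real.exp (ε * t)) (Real.exp (ε * t) * ε) t := fun t => by
    simpa using ((hasDerivAt_id t).const_mul ε).exp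
  -- The choice of `ε` gives `V' ≤ -ε V`.
  have hanti : Antitone fun t => Real.exp (ε * t) * V t := by
    refine antitone_of_hasDerivAt_nonpos (fun t => (hexp t).mul (hV t)) fun t => ?_
    have h1 := hdecay (e t)
    have h2 := mul_le_mul_of_nonneg_left h1 (Real.exp_pos (ε * t)).le
    change _ * V t + _ ≤ 0
    change _ ≤ _ * (-ε * V t) at h2
    linarith
  have hbound : ∀ t ≥ 0, e t ⬝ᵥ e t ≤ δ⁻¹ * V 0 * Real.exp (-(ε * t)) := fun t ht => by
    have h1 : Real.exp (ε * t) * V t ≤ V 0 := by simpa using hanti ht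
    have h2 : δ * (e t ⬝ᵥ e t) ≤ V t := by
      have := hcoer (e t)
      rw [Matrix.neg_mulVec, dotProduct_neg, Matrix.one_mulVec] at this
      change -V t ≤ _ at this
      linarith
    have h3 : V t ≤ V 0 * Real.exp (-(ε * t)) := by
      rw [Real.exp_neg, ← div_eq_mul_inv, le_div_iff₀ (Real.exp_pos _), mul_comm]
      exact h1
    rw [mul_assoc, inv_mul_eq_div, le_div_iff₀ hδ, mul_comm]
    exact h2.trans h3
  have hlim : Tendsto (fun t => δ⁻¹ * V 0 * Real.exp (-(ε * t))) atTop (𝓝 0) := by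
    have h1 := Real.tendsto_exp_neg_atTop_nhds_zero.comp (tendsto_id.const_mul_atTop hε)
    simpa using h1.const_mul (δ⁻¹ * V 0)
  rw [tendsto_pi_nhds]
  intro i
  have hsq : Tendsto (fun t => e t i * e t i) atTop (𝓝 0) :=
    tendsto_of_tendsto_of_tendsto_of_le_of_le' tendsto_const_nhds hlim
      (Eventually.of_forall fun t => mul_self_nonneg _) (by
        filter_upwards [eventually_ge_atTop 0] with t ht
        exact (Finset.single_le_sum (f := fun i => e t i * e t i)
          (fun j _ => mul_self_nonneg _) (Finset.mem_univ i)).trans (hbound t ht))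
  have habs := (Real.continuous_sqrt.tendsto 0).comp hsq
  rw [Real.sqrt_zero] at habs
  refine (tendsto_zero_iff_abs_tendsto_zero _).2 (habs.congr fun t => ?_)
  exact Real.sqrt_mul_self_eq_abs _

end Matrix

/-- Any design `(T, L)` yields a partial state estimator. -/
theorem LTISystem.IsDesign.isPartialStateEstimatorFor {q n m p r : ℕ} {S : LTISystem n m p r}
    {T : Matrix (Fin q) (Fin n) ℝ} {L : Matrix (Fin q) (Fin p) ℝ} (h : S.IsDesign T L) :
    (S.estimatorOf T L).IsPartialStateEstimatorFor S := by
  obtain ⟨hN, hT, hK⟩ := h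
  intro x u y z w zhat hx hw
  set N := (T * S.A - L * S.C) * Tᵀ with hNdef
  let e : ℝ → Fin q → ℝ := fun t => w t - T *ᵥ x t
  have hTx : LocallyAC fun t => T *ᵥ x t := hx.locAC_x.mulVec T
  have heAC : LocallyAC e := fun a b => (hw.locAC_w a b).fun_sub (hTx a b)
  have hae : ∀ᵐ t : ℝ, HasDerivAt e (N *ᵥ e t) t := by
    filter_upwards [hx.state_eq, hx.output_eq, hw.state_eq] with t h1 h2 h3
    have h4 : HasDerivAt (fun t => T *ᵥ x t) (T *ᵥ (S.A *ᵥ x t + S.B *ᵥ u t)) t :=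
      (LinearMap.toContinuousLinearMap T.mulVecLin).hasFDerivAt.comp_hasDerivAt t h1
    refine (h3.fun_sub h4).congr_deriv ?_
    change N *ᵥ w t + (T * S.B - L * S.D) *ᵥ u t + L *ᵥ y t - _ = _
    -- After substituting `y = C x + D u`, the terms in `u` cancel, and `T A = N T + L C` turns the
    -- rest into `N (w - T x)`.
    rw [h2]
    simp only [e, Matrix.mulVec_sub, Matrix.mulVec_add, Matrix.mulVec_mulVec, ← hT,
      Matrix.add_mulVec, Matrix.sub_mulVec]
    abel
  have hder := hasDerivAt_of_locallyAC heAC (N.mulVec_continuous.comp heAC.continuous) hae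
  have hlim := Matrix.tendsto_zero_of_isStableMatrix hN hder
  have hlim2 : Tendsto (fun t => (S.K * Tᵀ) *ᵥ e t) atTop (𝓝 0) := by
    have h := (((S.K * Tᵀ).mulVec_continuous).tendsto 0).comp hlim
    rwa [Matrix.mulVec_zero] at h
  refine essTendstoZero_of_tendsto hlim2 ?_
  filter_upwards [hx.functional_eq, hw.output_eq] with t h1 h2
  rw [h1, h2, Matrix.mulVec_sub, Matrix.mulVec_mulVec, hK]
  rfl

/-! ### Decaying functionals and stabilizing output injections. -/

namespace Matrix

variable {n p q : ℕ}

/-- The linear functionals that tend to zero along all trajectories `exp (t A) x` with `x` in the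
unobservable subspace of `(A, C)`. -/
def decayingFunctionals (A : Matrix (Fin n) (Fin n) ℝ) (C : Matrix (Fin p) (Fin n) ℝ) :
    Submodule ℝ (Fin n → ℝ) where
  carrier := {l | ∀ x, (∀ k : ℕ, C *ᵥ (A ^ k *ᵥ x) = 0) →
    Tendsto (fun t => l ⬝ᵥ (flow A t *ᵥ x)) atTop (𝓝 0)}
  zero_mem' x _ := by simp
  add_mem' {l l'} hl hl' x hx := by
    simpa [add_dotProduct] using (hl x hx).add (hl' x hx)
  smul_mem' c l hl x hx := by
    simpa [smul_dotProduct] using (hl x hx).const_mul c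

theorem row_mem_decayingFunctionals (A : Matrix (Fin n) (Fin n) ℝ) (C : Matrix (Fin p) (Fin n) ℝ)
    (i : Fin p) : C i ∈ decayingFunctionals A C := by
  intro x hx
  have h : ∀ t, C i ⬝ᵥ (flow A t *ᵥ x) = 0 := fun t =>
    congrFun (mulVec_flow_mulVec_eq_zero hx t) i
  simp [h]

theorem vecMul_flow_mem_decayingFunctionals {A : Matrix (Fin n) (Fin n) ℝ}
    {C : Matrix (Fin p) (Fin n) ℝ} {l : Fin n → ℝ} (hl : l ∈ decayingFunctionals A C) (s : ℝ) :
    l ᵥ* flow A s ∈ decayingFunctionals A C := by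
  intro x hx
  refine ((hl x hx).comp (tendsto_atTop_add_const_left atTop s tendsto_id)).congr fun t => ?_
  simp only [Function.comp_apply, id]
  rw [flow_add, ← Matrix.mulVec_mulVec, Matrix.dotProduct_mulVec]

/-- The space is invariant under the flow, by a time shift, and closed, being finite-dimensional. So
it contains the limit `l A` of the difference quotients at time zero. -/
theorem vecMul_mem_decayingFunctionals {A : Matrix (Fin n) (Fin n) ℝ}
    {C : Matrix (Fin p) (Fin n) ℝ} {l : Fin n → ℝ} (hl : l ∈ decayingFunctionals A C) :
    l ᵥ* A ∈ decayingFunctionals A C := by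
  have h := hasDerivAt_iff_tendsto_slope.1 (hasDerivAt_vecMul_flow_zero A l)
  refine (decayingFunctionals A C).closed_of_finiteDimensional.mem_of_tendsto h
    (Eventually.of_forall fun t => ?_)
  exact Submodule.smul_mem _ _ (Submodule.sub_mem _ (vecMul_flow_mem_decayingFunctionals hl t)
    (vecMul_flow_mem_decayingFunctionals hl 0))

theorem mul_eq_self_of_rows_mem {k : ℕ} {W : Submodule ℝ (Fin n → ℝ)} {Q : Matrix (Fin n) (Fin n) ℝ}
    (hQ : ∀ w ∈ W, w ᵥ* Q = w) {M : Matrix (Fin k) (Fin n) ℝ} (hM : ∀ i, M i ∈ W) : M * Q = M := by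
  ext i j
  exact congrFun (hQ (M i) (hM i)) j

/-- A dual certificate vanishes if all trajectories that start in the unobservable subspace tend to
zero. -/
theorem dual_certificate_eq_zero {A : Matrix (Fin q) (Fin q) ℝ} {C : Matrix (Fin p) (Fin q) ℝ}
    (hdet : ∀ y, (∀ k : ℕ, C *ᵥ (A ^ k *ᵥ y) = 0) →
      Tendsto (fun t => flow A t *ᵥ y) atTop (𝓝 0))
    {X : Matrix (Fin q) (Fin q) ℝ} (hX : X.PosSemidef) (h : (A * X + X * Aᵀ).PosSemidef)
    (hC : X * Cᵀ = 0) : X = 0 := by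
  obtain ⟨Y, hY⟩ := hX.exists_eq_transpose_mul_self
  have hXk : ∀ k : ℕ, ∀ v, X *ᵥ (Aᵀ ^ k *ᵥ (Cᵀ *ᵥ v)) = 0 := fun k v => by
    induction k with
    | zero => rw [pow_zero, Matrix.one_mulVec, Matrix.mulVec_mulVec, hC, Matrix.zero_mulVec]
    | succ k ih =>
      rw [pow_succ', ← Matrix.mulVec_mulVec]
      exact hX.mulVec_transpose_mulVec_eq_zero h ih
  -- The rows of `Y` are unobservable: the kernel of `X` contains the range of `Cᵀ` and is invariant
  -- under `Aᵀ`.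
  have hYk : ∀ k : ℕ, C * A ^ k * Yᵀ = 0 := fun k => by
    have h1 : Yᵀ * Y * (Aᵀ ^ k * Cᵀ) = 0 := by
      rw [← hY]
      refine Matrix.ext_of_mulVec_single fun j => ?_
      rw [← Matrix.mulVec_mulVec, ← Matrix.mulVec_mulVec, hXk, Matrix.zero_mulVec]
    have h2 := congrArg Matrix.transpose ((transpose_mul_self_mul_eq_zero_iff _ _).1 h1)
    simpa [Matrix.transpose_mul, Matrix.transpose_pow] using h2
  have hrow : ∀ i, Tendsto (fun t => flow A t *ᵥ Y i) atTop (𝓝 0) := fun i => by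
    refine hdet (Y i) fun k => ?_
    rw [Matrix.mulVec_mulVec]
    exact funext fun j => congrFun (congrFun (hYk k) j) i
  have hsym : Xᵀ = X := hX.isHermitian
  have hquad : ∀ v, v ⬝ᵥ (X *ᵥ v) = (Y *ᵥ v) ⬝ᵥ (Y *ᵥ v) := fun v => by
    rw [hY, ← Matrix.mulVec_mulVec, Matrix.dotProduct_mulVec, Matrix.vecMul_transpose]
  have hzero : ∀ v, v ⬝ᵥ (X *ᵥ v) = 0 := fun v => by
    refine le_antisymm ?_ (by simpa using hX.dotProduct_mulVec_nonneg v)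
    -- This function is nondecreasing because `A X + X Aᵀ ≥ 0`, and it tends to zero since `flow A
    -- t` sends the rows of `Y` to zero. Hence `φ 0 ≤ 0`.
    let φ : ℝ → ℝ := fun t => (flow Aᵀ t *ᵥ v) ⬝ᵥ (X *ᵥ (flow Aᵀ t *ᵥ v))
    have hmono : Monotone φ := by
      refine monotone_of_hasDerivAt_nonneg
        (fun t => hasDerivAt_dotProduct_mulVec (hasDerivAt_flow_mulVec Aᵀ v t)) fun t => ?_
      have := h.dotProduct_mulVec_nonneg (flow Aᵀ t *ᵥ v)
      rwa [star_trivial, add_comm] at this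
    have hlim : Tendsto φ atTop (𝓝 0) := by
      have h1 : ∀ i, Tendsto (fun t => (Y *ᵥ (flow Aᵀ t *ᵥ v)) i) atTop (𝓝 0) := fun i => by
        have hc : Continuous fun w : Fin q → ℝ => w ⬝ᵥ v := continuous_id.dotProduct continuous_const
        have h2 := (hc.tendsto 0).comp (hrow i)
        rw [zero_dotProduct] at h2
        refine h2.congr fun t => ?_
        change (flow A t *ᵥ Y i) ⬝ᵥ v = Y i ⬝ᵥ (flow Aᵀ t *ᵥ v)
        rw [flow_transpose, Matrix.dotProduct_mulVec, Matrix.vecMul_transpose]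
      have h3 : Tendsto (fun t => ∑ i, (Y *ᵥ (flow Aᵀ t *ᵥ v)) i * (Y *ᵥ (flow Aᵀ t *ᵥ v)) i) atTop
          (𝓝 (∑ _i : Fin q, 0 * 0)) := tendsto_finsetSum _ fun i _ => (h1 i).mul (h1 i)
      rw [mul_zero, Finset.sum_const_zero] at h3
      exact h3.congr fun t => (hquad _).symm
    have := hmono.ge_of_tendsto hlim 0
    simpa [φ] using this
  refine Matrix.ext_of_mulVec_single fun j => ?_
  rw [Matrix.zero_mulVec]
  exact (hX.dotProduct_mulVec_zero_iff _).1 (by simpa using hzero (Pi.single j 1))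

/-- If all trajectories that start in the unobservable subspace tend to zero, then some output
injection is stabilizing. -/
theorem exists_isStableMatrix_sub_mul {A : Matrix (Fin q) (Fin q) ℝ} {C : Matrix (Fin p) (Fin q) ℝ}
    (hdet : ∀ y, (∀ k : ℕ, C *ᵥ (A ^ k *ᵥ y) = 0) →
      Tendsto (fun t => flow A t *ᵥ y) atTop (𝓝 0)) :
    ∃ L : Matrix (Fin q) (Fin p) ℝ, IsStableMatrix (A - L * C) := by
  rcases exists_lyapunov_or_dual A C with ⟨P, σ, hP, h⟩ | ⟨X, h0, hX, h, hC⟩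
  -- Each of the two Lyapunov terms of `A - L C` then contributes half of `σ Cᵀ C`.
  · refine ⟨(σ / 2) • (P⁻¹ * Cᵀ), hP.isStableMatrix ?_⟩
    have hsym : Pᵀ = P := hP.isHermitian
    have hdet : IsUnit P.det := (Matrix.isUnit_iff_isUnit_det P).1 hP.isUnit
    have e1 : P * (A - (σ / 2) • (P⁻¹ * Cᵀ) * C) = P * A - (σ / 2) • (Cᵀ * C) := by
      rw [Matrix.mul_sub, Matrix.smul_mul, Matrix.mul_smul, ← Matrix.mul_assoc, ← Matrix.mul_assoc,
        Matrix.mul_nonsing_inv _ hdet, Matrix.one_mul]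
    have e2 : (A - (σ / 2) • (P⁻¹ * Cᵀ) * C)ᵀ * P = Aᵀ * P - (σ / 2) • (Cᵀ * C) := by
      have := congrArg Matrix.transpose e1
      rw [Matrix.transpose_mul, hsym] at this
      rw [this]
      simp [Matrix.transpose_mul, hsym]
    rw [e1, e2]
    convert h using 1
    have : σ • (Cᵀ * C) = (σ / 2) • (Cᵀ * C) + (σ / 2) • (Cᵀ * C) := by
      rw [← add_smul, add_halves]
    rw [this]
    abel
  · exact absurd (dual_certificate_eq_zero hdet hX h hC) h0

end Matrix

/-! ### Construction of the design. -/

namespace LTISystem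

variable {n m p r : ℕ}

/-- The free trajectory from an unobservable state has zero input and output, so partial
detectability compares it with the zero solution. -/
theorem row_K_mem_decayingFunctionals {S : LTISystem n m p r} (hS : S.PartiallyDetectable)
    (i : Fin r) : S.K i ∈ decayingFunctionals S.A S.C := by
  intro x hx
  have hc := continuous_flow_mulVec S.A x
  have hKc : Continuous fun t => S.K *ᵥ (flow S.A t *ᵥ x) := S.K.mulVec_continuous.comp hc
  have hx₁ : S.IsSolution (fun t => flow S.A t *ᵥ x) 0 0 (fun t => S.K *ᵥ (flow S.A t *ᵥ x)) := by
    refine ⟨hc.locallyIntegrable, locallyIntegrable_zero, locallyIntegrable_zero,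
      hKc.locallyIntegrable, LocallyAC.of_contDiff ?_, ?_, ?_, ?_⟩
    · rw [contDiff_one_iff_deriv]
      refine ⟨fun t => (hasDerivAt_flow_mulVec S.A x t).differentiableAt, ?_⟩
      rw [funext fun t => (hasDerivAt_flow_mulVec S.A x t).deriv]
      exact S.A.mulVec_continuous.comp hc
    · exact Eventually.of_forall fun t => by simpa using hasDerivAt_flow_mulVec S.A x t
    · exact Eventually.of_forall fun t => by simp [-mulVec_mulVec, mulVec_flow_mulVec_eq_zero hx t]
    · exact Eventually.of_forall fun t => rfl
  have hx₂ : S.IsSolution 0 0 0 0 := by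
    refine ⟨locallyIntegrable_zero, locallyIntegrable_zero, locallyIntegrable_zero,
      locallyIntegrable_zero, LocallyAC.of_contDiff contDiff_const, ?_, ?_, ?_⟩
    · exact Eventually.of_forall fun t => by
        simp [hasDerivAt_zero]
    · exact Eventually.of_forall fun t => by simp
    · exact Eventually.of_forall fun t => by simp
  have h1 := hS _ _ _ _ _ _ hx₁ hx₂
  simp only [Pi.zero_apply, sub_zero] at h1
  exact (tendsto_pi_nhds.1 (h1.tendsto hKc)) i

theorem PartiallyDetectable.exists_isDesign {S : LTISystem n m p r} (hS : S.PartiallyDetectable) :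
    ∃ (q : ℕ) (T : Matrix (Fin q) (Fin n) ℝ) (L : Matrix (Fin q) (Fin p) ℝ), S.IsDesign T L := by
  obtain ⟨q, T, hTW, hTT, hproj⟩ := exists_orthonormal_rows (decayingFunctionals S.A S.C)
  have hTA : T * S.A * (Tᵀ * T) = T * S.A :=
    mul_eq_self_of_rows_mem hproj fun i => vecMul_mem_decayingFunctionals (hTW i)
  have hC : S.C * (Tᵀ * T) = S.C :=
    mul_eq_self_of_rows_mem hproj fun i => row_mem_decayingFunctionals S.A S.C i
  have hK : S.K * (Tᵀ * T) = S.K :=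
    mul_eq_self_of_rows_mem hproj fun i => row_K_mem_decayingFunctionals hS i
  have hint : T * S.A = T * S.A * Tᵀ * T := by rw [Matrix.mul_assoc _ Tᵀ, hTA]
  have hTy : ∀ y, T *ᵥ (Tᵀ *ᵥ y) = y := fun y => by
    rw [Matrix.mulVec_mulVec, hTT, Matrix.one_mulVec]
  -- If `y` is unobservable for the reduced pair, then `Tᵀ y` is unobservable for `(A, C)`. Its
  -- trajectory is mapped by `T` to the reduced one, and it decays there because the rows of `T` are
  -- decaying functionals.
  obtain ⟨L, hL⟩ := exists_isStableMatrix_sub_mul (A := T * S.A * Tᵀ) (C := S.C * Tᵀ) fun y hy => by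
    have hx : ∀ k : ℕ, S.C *ᵥ (S.A ^ k *ᵥ (Tᵀ *ᵥ y)) = 0 := fun k => by
      rw [← hy k]
      conv_rhs => rw [← hTy y]
      conv_lhs => rw [← hC]
      simp only [Matrix.mulVec_mulVec, Matrix.mul_assoc]
      simp only [← Matrix.mul_assoc]
      rw [Matrix.mul_assoc (S.C * Tᵀ) T, mul_pow_eq_pow_mul hint]
      simp only [Matrix.mul_assoc]
    have hlim : Tendsto (fun t => T *ᵥ (flow S.A t *ᵥ (Tᵀ *ᵥ y))) atTop (𝓝 0) :=
      tendsto_pi_nhds.2 fun i => hTW i _ hx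
    refine hlim.congr fun t => ?_
    rw [mulVec_flow_mulVec_eq hint, hTy]
  have hN : (T * S.A - L * S.C) * Tᵀ = T * S.A * Tᵀ - L * (S.C * Tᵀ) := by
    rw [Matrix.sub_mul, Matrix.mul_assoc L]
  refine ⟨q, T, L, hN ▸ hL, ?_, by rw [Matrix.mul_assoc, hK]⟩
  rw [Matrix.mul_assoc, Matrix.sub_mul, hTA, Matrix.mul_assoc L, hC, sub_add_cancel]

end LTISystem

theorem mainTheorem3 {n m p r : ℕ} (S : LTISystem n m p r) (hS : S.PartiallyDetectable) :
    (∃ (q : ℕ) (E : LTIEstimator q m p r), E.IsPartialStateEstimatorFor S) ∧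
    (∃ (q : ℕ) (T : Matrix (Fin q) (Fin n) ℝ) (L : Matrix (Fin q) (Fin p) ℝ), S.IsDesign T L) ∧
    (∀ (q : ℕ) (T : Matrix (Fin q) (Fin n) ℝ) (L : Matrix (Fin q) (Fin p) ℝ),
      S.IsDesign T L → (S.estimatorOf T L).IsPartialStateEstimatorFor S) := by
  obtain ⟨q, T, L, h⟩ := hS.exists_isDesign
  exact ⟨⟨q, S.estimatorOf T L, h.isPartialStateEstimatorFor⟩, ⟨q, T, L, h⟩,
    fun _ _ _ h' => h'.isPartialStateEstimatorFor⟩
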